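/- Let $r>1$, let $p_1,\dots,p_r$ be distinct primes, let $\alpha_1,\dots,\alpha_r\ge 1$ be integers, and let $m=\prod_{i=1}^r p_i^{\alpha_i}$. For a finite set $S\subseteq\mathbb{Z}_m\setminus\{0\}$, a finite set $\mathcal{V}\subseteq(\mathbb{Z}_m)^h$ is called an *$S$-covering family* if $\langle \mathbf v,\mathbf v\rangle=0$ in $\mathbb{Z}_m$ for every $\mathbf v\in\mathcal V$, and for all distinct $\mathbf u,\mathbf v\in\mathcal V$: $\langle\mathbf u,\mathbf v\rangle=0$ in $\mathbb{Z}_m$ if $m$ divides the Hamming weight of the coordinatewise product $\mathbf u\circ\mathbf v\in(\mathbb{Z}_m)^h$, and $\langle\mathbf u,\mathbf v\rangle\in S$ otherwise. For a real number $c>0$ and an integer $h\ge m$, let $(\ast)_{c,h}$ denote the following condition on a family $\mathcal H$ of subsets of $\{1,\dots,h\}$: not all members of $\mathcal H$ have the same size, and 1. $|\mathcal H|>\exp\left(c\,\dfrac{1.5(\log h)^r}{(\log\log h)^{r-1}}\right)$; 2. $|H|\equiv 0\pmod m$ for every $H\in\mathcal H$; 3. for all distinct $G,H\in\mathcal H$: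 if $H\subset G$ or $G\subset H$ then $|G\cap H|\equiv0\pmod m$, and otherwise $|G\cap H|\not\equiv0\pmod m$; 4. for all distinct $G,H\in\mathcal H$ and every $i\in\{1,\dots,r\}$, $|G\cap H|\bmod p_i^{\alpha_i}\in\{0,1\}$. Then there exist a real number $c=c(m)>0$ and a set $S\subseteq\mathbb{Z}_m\setminus\{0\}$ with $|S|=2^r-1$ such that for every integer $h\ge m$ there is a family $\mathcal H$ satisfying $(\ast)_{c,h}$, and every family $\mathcal H=\{H_1,\dots,H_N\}$ (with the $H_i$ distinct) satisfying $(\ast)_{c,h}$ has the following property. The characteristic vectors $\mathbf v_1,\dots,\mathbf v_N\in(\mathbb{Z}_m)^h$ of $H_1,\dots,H_N$ are pairwise distinct, the set $\mathcal V=\{\mathbf v_1,\dots,\mathbf v_N\}$ is an $S$-covering family with $$N>\exp\left(c\,\frac{1.5(\log h)^r}{(\log\log h)^{r-1}}\right)$$ members, and $\langle\mathbf v_i,\mathbf v_j\rangle=|H_i\cap H_j|\bmod m$ for all $i,j\in\{1,\dots,N\}$. -/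

import Mathlib

/-- The characteristic vector in `(ℤ/mℤ)^h` of a subset of a universe of `h` elements. -/
def charVec (m : ℕ) {h : ℕ} (G : Finset (Fin h)) : Fin h → ZMod m :=
  fun x => if x ∈ G then 1 else 0

/-- The finite set `V` of vectors of `(ℤ/mℤ)^h` is an `S`-covering family.  The product `u * v` is
the coordinatewise (Hadamard) product, `hammingNorm` is the Hamming weight (the number of nonzero
coordinates, a natural number) and `u ⬝ᵥ v` is the inner product, with value in `ℤ/mℤ`. -/
structure IsCoveringFamily {m h : ℕ} (S : Finset (ZMod m)) (V : Finset (Fin h → ZMod m)) :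
    Prop where
  zero_notMem : (0 : ZMod m) ∉ S
  inner_self : ∀ v ∈ V, dotProduct v v = 0
  inner_of_dvd : ∀ u ∈ V, ∀ v ∈ V, u ≠ v → m ∣ hammingNorm (u * v) → dotProduct u v = 0
  inner_of_not_dvd : ∀ u ∈ V, ∀ v ∈ V, u ≠ v → ¬ m ∣ hammingNorm (u * v) → dotProduct u v ∈ S

/-- The lower bound `exp (c * 1.5 (log h)^r / (log log h)^(r-1))` (natural logarithms). -/
noncomputable def sizeBound (c : ℝ) (r h : ℕ) : ℝ :=
  Real.exp (c * (1.5 * Real.log h ^ r / Real.log (Real.log h) ^ (r - 1)))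

/-- `F` is a non-uniform set-system over a universe of `h` elements, with more than
`sizeBound c r h` members and with the prescribed member sizes and pairwise intersection sizes
modulo `m = ∏ i, p i ^ α i`. -/
structure IsCoveringSetSystem {r h : ℕ} (p α : Fin r → ℕ) (c : ℝ)
    (F : Finset (Finset (Fin h))) : Prop where
  nonuniform : ∃ G ∈ F, ∃ H ∈ F, G.card ≠ H.card
  size : sizeBound c r h < (F.card : ℝ)
  card_mod : ∀ H ∈ F, H.card % (∏ i, p i ^ α i) = 0
  inter_of_ssubset : ∀ G ∈ F, ∀ H ∈ F, G ≠ H → (H ⊂ G ∨ G ⊂ H) →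
    (G ∩ H).card % (∏ i, p i ^ α i) = 0
  inter_of_not_ssubset : ∀ G ∈ F, ∀ H ∈ F, G ≠ H → ¬ (H ⊂ G ∨ G ⊂ H) →
    (G ∩ H).card % (∏ i, p i ^ α i) ≠ 0
  inter_mod_primePow : ∀ G ∈ F, ∀ H ∈ F, G ≠ H → ∀ i,
    (G ∩ H).card % p i ^ α i = 0 ∨ (G ∩ H).card % p i ^ α i = 1

/-! ### Binomial coefficients modulo a prime -/

/-! Existence is a Grolmusz-type construction. Let `p i ^ e i` be the largest power of `p i` not
exceeding `t`, and take words over `t` letters of length `n = ∏ i, p i ^ e i - 1`. The number `a` of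
agreements of two words satisfies `a + 1 ≤ n + 1`, so `n + 1` divides `a + 1` only when the words
coincide. By Lucas, a binomial coefficient detects `p i ^ e i ∣ a + 1` modulo `p i`; Euler's theorem
lifts this test to a 0/1 value modulo `p i ^ α i`, and orthogonal idempotents glue the primes into
one number `f(a)`, divisible by `m` only for equal words (`dvd_agreementFunction_iff`).

Since `f` is built from sums, products and binomial coefficients with natural coefficients, `f(a)`
is an intersection size in a universe of `f(n * t) ≤ t ^ (D * t)` points, with `D` depending only on
`r` and `m`. The `t ^ n` sets form an antichain; adjoining `∅` breaks uniformity. As `log h` is of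
order `t log t` and `n` of order `t ^ r`, the size bound follows. For small `h`, a small `c` makes
two sets enough.

For characteristic vectors, inner products and Hamming weights of coordinatewise products both read
off `|G ∩ H|`, so the covering property holds with `S` the nonzero residues that are 0 or 1 modulo
every prime power. -/

theorem choose_pred_primePow_modEq {p : ℕ} (hp : p.Prime) (e a : ℕ) :
    a.choose (p ^ e - 1) ≡ (if p ^ e ∣ a + 1 then 1 else 0) [MOD p] := by
  have := Fact.mk hp
  have hp0 := hp.pos
  induction e generalizing a with
  | zero => simp [Nat.ModEq]
  | succ e ih =>
    have hpe : 0 < p ^ e := pow_pos hp0 e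
    -- All base-`p` digits of `p ^ (e + 1) - 1` equal `p - 1`; Lucas splits off the last one, and
    -- its factor is nonzero only if `a` also ends in `p - 1`.
    have hdecomp : p ^ (e + 1) - 1 = (p - 1) + p * (p ^ e - 1) := by
      have : p * (p ^ e - 1) = p * p ^ e - p := by rw [Nat.mul_sub, mul_one]
      have h2 : p ≤ p * p ^ e := Nat.le_mul_of_pos_right p hpe
      rw [pow_succ, mul_comm (p ^ e) p]
      omega
    have hmod : (p ^ (e + 1) - 1) % p = p - 1 := by
      rw [hdecomp, Nat.add_mul_mod_self_left, Nat.mod_eq_of_lt (by omega)]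
    have hdiv : (p ^ (e + 1) - 1) / p = p ^ e - 1 := by
      rw [hdecomp, Nat.add_mul_div_left _ _ hp0, Nat.div_eq_of_lt (by omega), zero_add]
    have key := Choose.choose_modEq_choose_mod_mul_choose_div_nat (p := p) (n := a)
      (k := p ^ (e + 1) - 1)
    rw [hmod, hdiv] at key
    refine key.trans ?_
    have hlt := Nat.mod_lt a hp0
    have ha := Nat.mod_add_div a p
    by_cases hr : a % p = p - 1
    · have h1 : a + 1 = p * (a / p + 1) := by
        rw [mul_add, mul_one]; omega
      have h2 : p ^ (e + 1) ∣ a + 1 ↔ p ^ e ∣ a / p + 1 := by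
        rw [h1, pow_succ, mul_comm (p ^ e) p]
        exact Nat.mul_dvd_mul_iff_left hp0
      rw [hr, Nat.choose_self, one_mul]
      simp only [h2]
      exact ih _
    · have h2 : ¬ p ^ (e + 1) ∣ a + 1 := by
        intro h
        have h3 : p ∣ a + 1 := (dvd_pow_self p (Nat.succ_ne_zero e)).trans h
        have h4 : p ∣ a % p + 1 := by
          rw [← ha, add_right_comm] at h3
          exact (Nat.dvd_add_left (dvd_mul_right p _)).1 h3
        have := Nat.le_of_dvd (by omega) h4
        omega
      rw [if_neg h2, Nat.choose_eq_zero_of_lt (by omega), zero_mul]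

/-- A polynomial in `a` vanishing modulo `p` exactly when `a ≡ -1` modulo `p ^ e`. -/
theorem prime_dvd_one_add_mul_choose_iff {p : ℕ} (hp : p.Prime) (e a : ℕ) :
    p ∣ 1 + (p - 1) * a.choose (p ^ e - 1) ↔ p ^ e ∣ a + 1 := by
  have h := ((choose_pred_primePow_modEq hp e a).mul_left (p - 1)).add_left 1
  rw [← Nat.modEq_zero_iff_dvd]
  have h1 := hp.one_lt
  split_ifs at h with hd
  · simp only [hd, iff_true]
    refine h.trans ?_
    rw [mul_one, Nat.add_sub_cancel' h1.le]
    simp [Nat.ModEq]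
  · simp only [hd, iff_false]
    intro h0
    have := h.symm.trans h0
    rw [mul_zero, add_zero, Nat.modEq_zero_iff_dvd, Nat.dvd_one] at this
    omega

theorem le_totient_primePow {p α : ℕ} (hp : p.Prime) (hα : 0 < α) :
    α ≤ (p ^ α).totient := by
  rw [Nat.totient_prime_pow hp hα]
  have h1 : α - 1 < p ^ (α - 1) := Nat.lt_pow_self hp.one_lt
  have h2 : p ^ (α - 1) * 1 ≤ p ^ (α - 1) * (p - 1) :=
    Nat.mul_le_mul_left _ (by have := hp.one_lt; omega)
  omega

/-- Euler's theorem handles units; for multiples of `p` the exponent is at least `α`. This lifts a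
test modulo `p` to a 0/1 value modulo `p ^ α`. -/
theorem pow_totient_primePow_modEq {p α : ℕ} (hp : p.Prime) (hα : 0 < α) (a : ℕ) :
    a ^ (p ^ α).totient ≡ (if p ∣ a then 0 else 1) [MOD p ^ α] := by
  split_ifs with h
  · rw [Nat.modEq_zero_iff_dvd]
    exact (pow_dvd_pow_of_dvd h α).trans (pow_dvd_pow a (le_totient_primePow hp hα))
  · exact Nat.ModEq.pow_totient
      (Nat.Coprime.pow_right α ((Nat.Prime.coprime_iff_not_dvd hp).2 h).symm)

/-! ### Functions realised as intersection sizes -/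

/-- `K x y` is the size of the intersection of the `x`-th and `y`-th member of a family of subsets
of a universe with `s` elements. -/
def IsIntersectionKernel {X : Type} (K : X → X → ℕ) (s : ℕ) : Prop :=
  ∃ (U : Type) (_ : Fintype U) (_ : DecidableEq U) (A : X → Finset U),
    Fintype.card U = s ∧ ∀ x y, (A x ∩ A y).card = K x y

namespace IsIntersectionKernel

variable {X : Type} {K L : X → X → ℕ} {s t : ℕ}

theorem const (X : Type) (k : ℕ) : IsIntersectionKernel (fun _ _ : X => k) k :=
  ⟨Fin k, inferInstance, inferInstance, fun _ => Finset.univ, by simp, by simp⟩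

/-- Disjoint unions add, products multiply, and passing to `k`-subsets takes binomial coefficients;
universe sizes change by the same operations as intersections. -/
theorem add (hK : IsIntersectionKernel K s) (hL : IsIntersectionKernel L t) :
    IsIntersectionKernel (fun x y => K x y + L x y) (s + t) := by
  obtain ⟨U, _, _, A, hU, hA⟩ := hK
  obtain ⟨V, _, _, B, hV, hB⟩ := hL
  refine ⟨U ⊕ V, inferInstance, inferInstance, fun x => (A x).disjSum (B x), ?_, fun x y => ?_⟩
  · rw [Fintype.card_sum, hU, hV]
  · dsimp only
    rw [← hA, ← hB, ← Finset.card_disjSum]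
    congr 1
    ext (u | v) <;> simp

theorem mul (hK : IsIntersectionKernel K s) (hL : IsIntersectionKernel L t) :
    IsIntersectionKernel (fun x y => K x y * L x y) (s * t) := by
  obtain ⟨U, _, _, A, hU, hA⟩ := hK
  obtain ⟨V, _, _, B, hV, hB⟩ := hL
  refine ⟨U × V, inferInstance, inferInstance, fun x => A x ×ˢ B x, ?_, fun x y => ?_⟩
  · rw [Fintype.card_prod, hU, hV]
  · dsimp only
    rw [← hA, ← hB, ← Finset.card_product, Finset.product_inter_product]

theorem pow (hK : IsIntersectionKernel K s) (k : ℕ) :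
    IsIntersectionKernel (fun x y => K x y ^ k) (s ^ k) := by
  induction k with
  | zero => simpa using const X 1
  | succ k ih => simpa only [pow_succ] using ih.mul hK

theorem choose (hK : IsIntersectionKernel K s) (k : ℕ) :
    IsIntersectionKernel (fun x y => (K x y).choose k) (s.choose k) := by
  obtain ⟨U, _, _, A, hU, hA⟩ := hK
  refine ⟨{ T : Finset U // T.card = k }, inferInstance, inferInstance,
    fun x => Finset.univ.filter fun T => T.1 ⊆ A x, ?_, fun x y => ?_⟩
  · rw [Fintype.card_finset_len, hU]
  · dsimp only
    rw [← hA, ← Finset.card_powersetCard, ← Finset.card_map (Function.Embedding.subtype _)]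
    congr 1
    ext T
    simp [Finset.mem_powersetCard, Finset.subset_inter_iff, and_comm, and_left_comm]

theorem sum {ι : Type} (I : Finset ι) {K : ι → X → X → ℕ} {s : ι → ℕ}
    (hK : ∀ i, IsIntersectionKernel (K i) (s i)) :
    IsIntersectionKernel (fun x y => ∑ i ∈ I, K i x y) (∑ i ∈ I, s i) := by
  classical
  induction I using Finset.induction_on with
  | empty => simpa using const X 0
  | insert i I hi ih => simpa only [Finset.sum_insert hi] using (hK i).add ih

/-- The number of agreements of two words. -/
theorem agreement (n N : ℕ) :
    IsIntersectionKernel (fun x y : Fin n → Fin N => (Finset.univ.filter fun i => x i = y i).card)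
      (n * N) := by
  -- A word is represented by its graph.
  refine ⟨Fin n × Fin N, inferInstance, inferInstance,
    fun x => Finset.univ.filter fun u => u.2 = x u.1, by simp, fun x y => ?_⟩
  symm
  refine Finset.card_bij (fun i _ => (i, x i)) ?_ ?_ ?_
  · intro i hi
    simpa using hi
  · intro i _ j _ h
    exact (Prod.ext_iff.1 h).1
  · rintro ⟨i, w⟩ hu
    simp only [Finset.mem_inter, Finset.mem_filter, Finset.mem_univ, true_and] at hu
    exact ⟨i, by simp [← hu.1, ← hu.2], by simp [hu.1]⟩

/-- A family in a universe of `s` elements can be transported to any larger universe `Fin h`. -/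
theorem exists_fin (hK : IsIntersectionKernel K s) {h : ℕ} (hs : s ≤ h) :
    ∃ A : X → Finset (Fin h), ∀ x y, (A x ∩ A y).card = K x y := by
  obtain ⟨U, _, _, A, hU, hA⟩ := hK
  obtain ⟨f⟩ : Nonempty (U ↪ Fin h) :=
    Function.Embedding.nonempty_of_card_le (by simpa [hU] using hs)
  exact ⟨fun x => (A x).map f, fun x y => by rw [← Finset.map_inter, Finset.card_map, hA]⟩

end IsIntersectionKernel

/-! ### Products of powers of distinct primes -/

section CRT

variable {r : ℕ} {p : Fin r → ℕ}

theorem pairwise_coprime_primePow (hp : ∀ i, (p i).Prime) (hp_inj : Function.Injective p)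
    (e : Fin r → ℕ) : Pairwise (Function.onFun Nat.Coprime fun i => p i ^ e i) :=
  fun i j hij => Nat.Coprime.pow _ _
    ((Nat.coprime_primes (hp i) (hp j)).2 (hp_inj.ne hij))

theorem prod_primePow_dvd_iff (hp : ∀ i, (p i).Prime) (hp_inj : Function.Injective p)
    (e : Fin r → ℕ) (a : ℕ) : (∏ i, p i ^ e i) ∣ a ↔ ∀ i, p i ^ e i ∣ a :=
  ⟨fun h i => (Finset.dvd_prod_of_mem _ (Finset.mem_univ i)).trans h,
    fun h => Fintype.prod_dvd_of_isRelPrime (fun _ _ hij =>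
      Nat.coprime_iff_isRelPrime.1 (pairwise_coprime_primePow hp hp_inj e hij)) h⟩

theorem modEq_prod_primePow_iff (hp : ∀ i, (p i).Prime) (hp_inj : Function.Injective p)
    (e : Fin r → ℕ) (a b : ℕ) :
    a ≡ b [MOD ∏ i, p i ^ e i] ↔ ∀ i, a ≡ b [MOD p i ^ e i] := by
  wlog hab : a ≤ b generalizing a b
  · simpa only [Nat.ModEq.comm (b := b)] using this b a (le_of_not_ge hab)
  · simp only [Nat.modEq_iff_dvd' hab, prod_primePow_dvd_iff hp hp_inj]

/-- Orthogonal idempotents. -/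
theorem exists_idempotent (hp : ∀ i, (p i).Prime) (hp_inj : Function.Injective p)
    (α : Fin r → ℕ) (i : Fin r) :
    ∃ M < ∏ j, p j ^ α j, ∀ j, M ≡ (if j = i then 1 else 0) [MOD p j ^ α j] := by
  have hpos : 0 < ∏ j, p j ^ α j := Finset.prod_pos fun j _ => pow_pos (hp j).pos _
  obtain ⟨k, hk⟩ := Nat.chineseRemainderOfFinset (fun j => if j = i then 1 else 0)
    (fun j => p j ^ α j) Finset.univ (fun j _ => (pow_pos (hp j).pos _).ne')
    (fun a _ b _ hab => pairwise_coprime_primePow hp hp_inj α hab)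
  -- Reduction keeps the coefficient below the modulus, which later bounds the universe size.
  refine ⟨k % ∏ j, p j ^ α j, Nat.mod_lt _ hpos, fun j => ?_⟩
  refine Nat.ModEq.trans ?_ (hk j (Finset.mem_univ j))
  exact (Nat.mod_modEq k _).of_dvd
    (Finset.dvd_prod_of_mem (fun j => p j ^ α j) (Finset.mem_univ j))

/-- The residues modulo `∏ i, p i ^ α i` that are `0` or `1` modulo every `p i ^ α i`. -/
theorem card_zeroOneResidues (hp : ∀ i, (p i).Prime) (hp_inj : Function.Injective p)
    {α : Fin r → ℕ} (hα : ∀ i, 0 < α i) [NeZero (∏ i, p i ^ α i)] :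
    (Finset.univ.filter fun s : ZMod (∏ i, p i ^ α i) =>
      ∀ i, s.val % p i ^ α i = 0 ∨ s.val % p i ^ α i = 1).card = 2 ^ r := by
  have hlt : ∀ i, 1 < p i ^ α i := fun i => Nat.one_lt_pow (hα i).ne' (hp i).one_lt
  choose M hM hMm using exists_idempotent hp hp_inj α
  have hpow : (2 : ℕ) ^ r = (Finset.univ : Finset (Fin r → Fin 2)).card := by simp
  rw [hpow]
  -- Combining the idempotents with coefficients `b` realises each 0/1 pattern of residues.
  have hinv : ∀ (b : Fin r → Fin 2) (i : Fin r),
      (∑ j, M j * (b j : ℕ)) % p i ^ α i = (b i : ℕ) := by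
    intro b i
    have h1 : (∑ j, M j * (b j : ℕ)) ≡ ∑ j, (if i = j then 1 else 0) * (b j : ℕ)
        [MOD p i ^ α i] :=
      Nat.ModEq.sum fun j _ => (hMm j i).mul_right _
    simp only [ite_mul, one_mul, zero_mul, Finset.sum_ite_eq, Finset.mem_univ, if_true] at h1
    rw [h1]
    exact Nat.mod_eq_of_lt (by have := (b i).isLt; have := hlt i; omega)
  have hval : ∀ (b : Fin r → Fin 2) (i : Fin r),
      ((∑ j, M j * (b j : ℕ) : ℕ) : ZMod (∏ i, p i ^ α i)).val % p i ^ α i = (b i : ℕ) := by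
    intro b i
    rw [ZMod.val_natCast, Nat.mod_mod_of_dvd _ (Finset.dvd_prod_of_mem _ (Finset.mem_univ i)),
      hinv]
  symm
  refine Finset.card_bij (fun b _ => ((∑ j, M j * (b j : ℕ) : ℕ) : ZMod _)) ?_ ?_ ?_
  · intro b _
    simp only [Finset.mem_filter, Finset.mem_univ, true_and, hval]
    intro i
    have := (b i).isLt
    omega
  · intro b _ b' _ hbb
    funext i
    apply Fin.ext
    rw [← hval b i, ← hval b' i, hbb]
  · intro s hs
    simp only [Finset.mem_filter, Finset.mem_univ, true_and] at hs
    have hs2 : ∀ i, s.val % p i ^ α i < 2 := fun i => by have := hs i; omega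
    refine ⟨fun i => ⟨s.val % p i ^ α i, hs2 i⟩, Finset.mem_univ _, ?_⟩
    conv_rhs => rw [← ZMod.natCast_zmod_val s]
    rw [ZMod.natCast_eq_natCast_iff]
    refine (modEq_prod_primePow_iff hp hp_inj α _ _).2 fun i => ?_
    have h1 : (∑ j, M j * (s.val % p j ^ α j)) % p i ^ α i = s.val % p i ^ α i :=
      hinv (fun i => ⟨s.val % p i ^ α i, hs2 i⟩) i
    exact h1

end CRT

/-! ### The set system with `0`-`1` intersections modulo prime powers -/

section Construction

variable {r : ℕ} {p : Fin r → ℕ}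

/-- A function of the number `a` of agreements with values `0`, `1` modulo every `p i ^ α i`, which
vanishes modulo `∏ i, p i ^ α i` only if `a ≡ -1` modulo every `p i ^ e i`. -/
def agreementFunction (p α e M : Fin r → ℕ) (a : ℕ) : ℕ :=
  ∑ i, M i * (1 + (p i - 1) * a.choose (p i ^ e i - 1)) ^ (p i ^ α i).totient

theorem agreementFunction_modEq (hp : ∀ i, (p i).Prime) {α e M : Fin r → ℕ} (hα : ∀ i, 0 < α i)
    (hM : ∀ i j, M i ≡ (if j = i then 1 else 0) [MOD p j ^ α j]) (a : ℕ) (i : Fin r) :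
    agreementFunction p α e M a ≡ (if p i ^ e i ∣ a + 1 then 0 else 1) [MOD p i ^ α i] := by
  have h1 : agreementFunction p α e M a ≡ ∑ j, (if i = j then 1 else 0) *
      (1 + (p j - 1) * a.choose (p j ^ e j - 1)) ^ (p j ^ α j).totient [MOD p i ^ α i] :=
    Nat.ModEq.sum fun j _ => (hM j i).mul_right _
  simp only [ite_mul, one_mul, zero_mul, Finset.sum_ite_eq, Finset.mem_univ, if_true] at h1
  have h2 := pow_totient_primePow_modEq (hp i) (hα i)
    (1 + (p i - 1) * a.choose (p i ^ e i - 1))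
  simp only [prime_dvd_one_add_mul_choose_iff (hp i)] at h2
  exact h1.trans h2

theorem agreementFunction_mod (hp : ∀ i, (p i).Prime) {α e M : Fin r → ℕ} (hα : ∀ i, 0 < α i)
    (hM : ∀ i j, M i ≡ (if j = i then 1 else 0) [MOD p j ^ α j]) (a : ℕ) (i : Fin r) :
    agreementFunction p α e M a % p i ^ α i = 0 ∨ agreementFunction p α e M a % p i ^ α i = 1 := by
  have h := agreementFunction_modEq (e := e) hp hα hM a i
  have h1 : 1 < p i ^ α i := Nat.one_lt_pow (hα i).ne' (hp i).one_lt
  split_ifs at h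
  · exact Or.inl (Nat.mod_eq_zero_of_dvd ((Nat.modEq_zero_iff_dvd).1 h))
  · exact Or.inr (Nat.ModEq.eq_1 _ _ _ ▸ h |>.trans (Nat.mod_eq_of_lt h1))

theorem dvd_agreementFunction_iff (hp : ∀ i, (p i).Prime) (hp_inj : Function.Injective p)
    {α e M : Fin r → ℕ} (hα : ∀ i, 0 < α i)
    (hM : ∀ i j, M i ≡ (if j = i then 1 else 0) [MOD p j ^ α j]) (a : ℕ) :
    (∏ i, p i ^ α i) ∣ agreementFunction p α e M a ↔ (∏ i, p i ^ e i) ∣ a + 1 := by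
  rw [prod_primePow_dvd_iff hp hp_inj, prod_primePow_dvd_iff hp hp_inj]
  refine forall_congr' fun i => ?_
  have h := agreementFunction_modEq (e := e) hp hα hM a i
  have h1 : 1 < p i ^ α i := Nat.one_lt_pow (hα i).ne' (hp i).one_lt
  rw [← Nat.modEq_zero_iff_dvd]
  split_ifs at h with hd
  · simp [hd, h]
  · simp only [hd, iff_false]
    intro h0
    have h2 := h.symm.trans h0
    rw [Nat.modEq_zero_iff_dvd, Nat.dvd_one] at h2
    omega

theorem isIntersectionKernel_agreementFunction (p α e M : Fin r → ℕ) (n N : ℕ) :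
    IsIntersectionKernel (fun x y : Fin n → Fin N =>
      agreementFunction p α e M (Finset.univ.filter fun i => x i = y i).card)
      (agreementFunction p α e M (n * N)) :=
  IsIntersectionKernel.sum Finset.univ fun i =>
    (IsIntersectionKernel.const _ (M i)).mul
      (((IsIntersectionKernel.const _ 1).add ((IsIntersectionKernel.const _ (p i - 1)).mul
        ((IsIntersectionKernel.agreement n N).choose (p i ^ e i - 1)))).pow _)

/-- The value `b = n * t` gives the universe size; only the linear dependence on `t` of the exponent
matters. -/
theorem agreementFunction_le (hp : ∀ i, (p i).Prime) {α e M : Fin r → ℕ} {m t b : ℕ}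
    (hr : r ≤ t) (hmt : m ≤ t) (hpm : ∀ i, p i ≤ m) (hM : ∀ i, M i ≤ m)
    (hαm : ∀ i, p i ^ α i ≤ m) (he : ∀ i, p i ^ e i ≤ t) (hb : b ≤ t ^ (r + 1)) (ht : 0 < t) :
    agreementFunction p α e M b ≤ t ^ (((r + 1) * m + m + 2) * t) := by
  have hterm : ∀ i, M i * (1 + (p i - 1) * b.choose (p i ^ e i - 1)) ^ (p i ^ α i).totient ≤
      t * (t * t ^ ((r + 1) * t)) ^ m := by
    intro i
    have h1 : b.choose (p i ^ e i - 1) ≤ t ^ ((r + 1) * t) :=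
      calc b.choose (p i ^ e i - 1) ≤ b ^ (p i ^ e i - 1) := Nat.choose_le_pow _ _
        _ ≤ (t ^ (r + 1)) ^ (p i ^ e i - 1) := Nat.pow_le_pow_left hb _
        _ ≤ (t ^ (r + 1)) ^ t :=
          Nat.pow_le_pow_right (pow_pos ht _) ((Nat.sub_le _ _).trans (he i))
        _ = t ^ ((r + 1) * t) := (pow_mul _ _ _).symm
    have h2 : 1 + (p i - 1) * b.choose (p i ^ e i - 1) ≤ t * t ^ ((r + 1) * t) :=
      calc 1 + (p i - 1) * b.choose (p i ^ e i - 1)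
          ≤ t ^ ((r + 1) * t) + (p i - 1) * t ^ ((r + 1) * t) :=
            add_le_add (Nat.one_le_pow _ _ ht) (Nat.mul_le_mul_left _ h1)
        _ = p i * t ^ ((r + 1) * t) := by
            have h3 := Nat.sub_add_cancel (hp i).one_le
            conv_rhs => rw [← h3]
            ring
        _ ≤ t * t ^ ((r + 1) * t) := Nat.mul_le_mul_right _ ((hpm i).trans hmt)
    refine Nat.mul_le_mul ((hM i).trans hmt) ((Nat.pow_le_pow_left h2 _).trans ?_)
    exact Nat.pow_le_pow_right (by positivity) ((Nat.totient_le _).trans (hαm i))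
  calc agreementFunction p α e M b ≤ ∑ _i : Fin r, t * (t * t ^ ((r + 1) * t)) ^ m :=
        Finset.sum_le_sum fun i _ => hterm i
    _ = r * (t * (t * t ^ ((r + 1) * t)) ^ m) := by simp
    _ ≤ t * (t * (t * t ^ ((r + 1) * t)) ^ m) := Nat.mul_le_mul_right _ hr
    _ = t ^ ((r + 1) * m * t + m + 2) := by ring
    _ ≤ t ^ (((r + 1) * m + m + 2) * t) := by
        refine Nat.pow_le_pow_right ht ?_
        nlinarith [Nat.mul_le_mul_left (m + 2) ht]

theorem card_agreement_lt {n N : ℕ} {x y : Fin n → Fin N} (hxy : x ≠ y) :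
    (Finset.univ.filter fun i => x i = y i).card < n := by
  obtain ⟨j, hj⟩ := Function.ne_iff.1 hxy
  calc (Finset.univ.filter fun i => x i = y i).card < (Finset.univ : Finset (Fin n)).card :=
        Finset.card_lt_card (Finset.filter_ssubset.2 ⟨j, Finset.mem_univ j, hj⟩)
    _ = n := by simp

theorem le_prod_primePow (hp : ∀ i, (p i).Prime) {α : Fin r → ℕ} (hα : ∀ i, 0 < α i) : r ≤ ∏ i, p i ^ α i := by
  have h1 : (2 : ℕ) ^ r ≤ ∏ i, p i ^ α i := by
    have := Finset.prod_le_prod' (s := (Finset.univ : Finset (Fin r))) (f := fun _ => 2)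
      (g := fun i => p i ^ α i) fun i _ =>
        (hp i).two_le.trans (Nat.le_self_pow (hα i).ne' _)
    simpa using this
  exact Nat.lt_two_pow_self.le.trans h1

/-- The family of subsets of `Fin h` indexed by the words of length `n` over `t` letters. -/
theorem exists_zeroOneFamily (hr : 0 < r) (hp : ∀ i, (p i).Prime) (hp_inj : Function.Injective p)
    {α : Fin r → ℕ} (hα : ∀ i, 0 < α i) {m : ℕ} (hm : m = ∏ i, p i ^ α i) {t h : ℕ} (hmt : m ≤ t)
    (hh : t ^ (((r + 1) * m + m + 2) * t) ≤ h) :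
    ∃ n, 0 < n ∧ t ^ r ≤ m * (n + 1) ∧ ∃ A : (Fin n → Fin t) → Finset (Fin h),
      (∀ x y, m ∣ (A x ∩ A y).card ↔ x = y) ∧
      ∀ x y i, (A x ∩ A y).card % p i ^ α i = 0 ∨ (A x ∩ A y).card % p i ^ α i = 1 := by
  have hαm : ∀ i, p i ^ α i ≤ m := fun i => hm ▸ Nat.le_of_dvd
    (Finset.prod_pos fun j _ => pow_pos (hp j).pos _)
    (Finset.dvd_prod_of_mem (fun j => p j ^ α j) (Finset.mem_univ i))
  have hpm : ∀ i, p i ≤ m := fun i => (Nat.le_self_pow (hα i).ne' _).trans (hαm i)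
  have ht : 0 < t := (hp ⟨0, hr⟩).pos.trans_le ((hpm _).trans hmt)
  set e : Fin r → ℕ := fun i => Nat.log (p i) t with he
  have hq : ∀ i, p i ^ e i ≤ t := fun i => Nat.pow_log_le_self _ ht.ne'
  have hQ2 : 1 < ∏ i, p i ^ e i := by
    have h1 : ∀ i, 1 < p i ^ e i := fun i =>
      Nat.one_lt_pow (Nat.log_pos (hp i).one_lt ((hpm i).trans hmt)).ne' (hp i).one_lt
    exact (h1 ⟨0, hr⟩).trans_le (Nat.le_of_dvd (Finset.prod_pos fun j _ => (h1 j).le)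
      (Finset.dvd_prod_of_mem (fun j => p j ^ e j) (Finset.mem_univ _)))
  have hQt : ∏ i, p i ^ e i ≤ t ^ r := by
    have := Finset.prod_le_prod' (s := (Finset.univ : Finset (Fin r))) (g := fun _ => t)
      (f := fun i => p i ^ e i) fun i _ => hq i
    simpa using this
  -- By maximality `t < p i ^ (e i + 1)`, so rounding down to prime powers loses at most a factor
  -- `m` overall.
  have htQ : t ^ r ≤ m * ∏ i, p i ^ e i := by
    have h1 := Finset.prod_le_prod' (s := (Finset.univ : Finset (Fin r))) (f := fun _ => t)
      (g := fun i => p i ^ α i * p i ^ e i) fun i _ =>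
        calc t ≤ p i ^ (e i + 1) := (Nat.lt_pow_succ_log_self (hp i).one_lt t).le
          _ = p i * p i ^ e i := by ring
          _ ≤ p i ^ α i * p i ^ e i := Nat.mul_le_mul_right _ (Nat.le_self_pow (hα i).ne' _)
    rw [Finset.prod_mul_distrib, ← hm] at h1
    simpa using h1
  choose M hM hMm using exists_idempotent hp hp_inj α
  rw [← hm] at hM
  obtain ⟨n, hn⟩ : ∃ n, ∏ i, p i ^ e i = n + 1 := ⟨_, (Nat.sub_add_cancel hQ2.le).symm⟩
  have hnt : n * t ≤ t ^ (r + 1) := by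
    rw [pow_succ]
    exact Nat.mul_le_mul_right _ (by omega)
  have hle := agreementFunction_le (e := e) hp ((hm ▸ le_prod_primePow hp hα).trans hmt) hmt
    hpm (fun i => (hM i).le) hαm hq hnt ht
  obtain ⟨A, hA⟩ := (isIntersectionKernel_agreementFunction p α e M n t).exists_fin (hle.trans hh)
  refine ⟨n, by omega, hn ▸ htQ, A, fun x y => ?_, fun x y i => ?_⟩
  · rw [hA, hm, dvd_agreementFunction_iff hp hp_inj hα hMm, hn]
    constructor
    · intro hd
      by_contra hxy
      have := card_agreement_lt hxy
      have := Nat.le_of_dvd (by omega) hd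
      omega
    · rintro rfl
      simp
  · rw [hA]
    exact agreementFunction_mod hp hα hMm _ i

theorem exists_isCoveringSetSystem_of_le (hr : 0 < r) (hp : ∀ i, (p i).Prime)
    (hp_inj : Function.Injective p) {α : Fin r → ℕ} (hα : ∀ i, 0 < α i) {m : ℕ}
    (hm : m = ∏ i, p i ^ α i) {t h : ℕ} (hmt : m ≤ t)
    (hh : t ^ (((r + 1) * m + m + 2) * t) ≤ h) :
    ∃ n, 0 < n ∧ t ^ r ≤ m * (n + 1) ∧ ∀ c : ℝ, sizeBound c r h ≤ (t : ℝ) ^ n →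
      ∃ F : Finset (Finset (Fin h)), IsCoveringSetSystem p α c F := by
  obtain ⟨n, hn, htn, A, hA, hA1⟩ := exists_zeroOneFamily hr hp hp_inj hα hm hmt hh
  refine ⟨n, hn, htn, fun c hc => ?_⟩
  have hm2 : 2 ≤ m := by
    have h1 : p ⟨0, hr⟩ ∣ m := hm ▸ (dvd_pow_self _ (hα _).ne').trans
      (Finset.dvd_prod_of_mem (fun j => p j ^ α j) (Finset.mem_univ (⟨0, hr⟩ : Fin r)))
    have h0 : 0 < m := hm ▸ Finset.prod_pos fun j _ => pow_pos (hp j).pos _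
    exact (hp _).two_le.trans (Nat.le_of_dvd h0 h1)
  have hself : ∀ x, m ∣ (A x).card := fun x => by simpa using (hA x x).2 rfl
  -- Containment would make the intersection `A x`, whose size is divisible by `m`.
  have hnot : ∀ x y, x ≠ y → ¬ A x ⊆ A y := fun x y hxy hsub => by
    have h1 := hself x
    rw [← Finset.inter_eq_left.2 hsub] at h1
    exact hxy ((hA x y).1 h1)
  have hne : ∀ x, A x ≠ ∅ := fun x hx => by
    obtain ⟨y, hy⟩ : ∃ y, x ≠ y :=
      -- A word differing from `x` everywhere; an empty `A x` would lie in its set.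
      ⟨fun i => if (x i).1 = 0 then ⟨1, by omega⟩ else ⟨0, by omega⟩, fun h => by
        have h1 := congrArg Fin.val (congrFun h ⟨0, hn⟩)
        split_ifs at h1 with h2
        · simp [h2] at h1
        · exact h2 h1⟩
    exact hnot x y hy (by simp [hx])
  have hinj : Function.Injective A := fun x y hxy => by
    by_contra h
    exact hnot x y h hxy.subset
  have hempty : ∅ ∉ Finset.univ.image A := by simpa using hne
  have hmem : ∀ G ∈ insert ∅ (Finset.univ.image A), G = ∅ ∨ ∃ x, A x = G := by
    intro G hG
    simpa using hG
  refine ⟨insert ∅ (Finset.univ.image A), ?_, ?_, ?_, ?_, ?_, ?_⟩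
  · refine ⟨∅, Finset.mem_insert_self _ _, A fun _ => ⟨0, by omega⟩,
      Finset.mem_insert_of_mem (Finset.mem_image_of_mem _ (Finset.mem_univ _)), ?_⟩
    rw [Finset.card_empty]
    exact (Finset.card_pos.2 (Finset.nonempty_iff_ne_empty.2 (hne _))).ne
  · rw [Finset.card_insert_of_notMem hempty, Finset.card_image_of_injective _ hinj]
    simp only [Finset.card_univ, Fintype.card_fun, Fintype.card_fin]
    push_cast
    linarith
  · intro H hH
    rcases hmem H hH with rfl | ⟨x, rfl⟩
    · simp
    · exact Nat.mod_eq_zero_of_dvd (hm ▸ hself x)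
  · intro G hG H hH hGH hs
    rcases hmem G hG with rfl | ⟨x, rfl⟩
    · simp
    rcases hmem H hH with rfl | ⟨y, rfl⟩
    · simp
    have hxy : x ≠ y := fun h => hGH (h ▸ rfl)
    rcases hs with hs | hs
    · exact (hnot y x hxy.symm hs.subset).elim
    · exact (hnot x y hxy hs.subset).elim
  · intro G hG H hH hGH hs
    rcases hmem G hG with rfl | ⟨x, rfl⟩
    · exact (hs (Or.inr (Finset.empty_ssubset.2 (Finset.nonempty_iff_ne_empty.2 hGH.symm)))).elim
    rcases hmem H hH with rfl | ⟨y, rfl⟩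
    · exact (hs (Or.inl (Finset.empty_ssubset.2 (Finset.nonempty_iff_ne_empty.2 hGH)))).elim
    have hxy : x ≠ y := fun h => hGH (h ▸ rfl)
    intro h0
    exact hxy ((hA x y).1 (hm ▸ Nat.dvd_of_mod_eq_zero h0))
  · intro G hG H hH _ i
    rcases hmem G hG with rfl | ⟨x, rfl⟩
    · simp
    rcases hmem H hH with rfl | ⟨y, rfl⟩
    · simp
    exact hA1 x y i

/-- The system consisting of the empty set and a set with `m` elements. -/
theorem exists_isCoveringSetSystem_of_sizeBound_lt_two (hp : ∀ i, (p i).Prime) {α : Fin r → ℕ}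
    {m : ℕ} (hm : m = ∏ i, p i ^ α i) {h : ℕ} (hh : m ≤ h) {c : ℝ} (hc : sizeBound c r h < 2) :
    ∃ F : Finset (Finset (Fin h)), IsCoveringSetSystem p α c F := by
  have hm0 : 0 < m := hm ▸ Finset.prod_pos fun j _ => pow_pos (hp j).pos _
  obtain ⟨B, -, hB⟩ := Finset.exists_subset_card_eq (s := (Finset.univ : Finset (Fin h)))
    (n := m) (by simpa using hh)
  have hB0 : B ≠ ∅ := by rintro rfl; simp at hB; omega
  have hB1 : ∅ ⊂ B := Finset.empty_ssubset.2 (Finset.nonempty_iff_ne_empty.2 hB0)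
  have hmem : ∀ G ∈ ({∅, B} : Finset (Finset (Fin h))), G = ∅ ∨ G = B := by simp
  have hinter : ∀ G ∈ ({∅, B} : Finset (Finset (Fin h))), ∀ H ∈ ({∅, B} : Finset (Finset (Fin h))),
      G ≠ H → G ∩ H = ∅ ∧ (H ⊂ G ∨ G ⊂ H) := by
    intro G hG H hH hGH
    rcases hmem G hG with rfl | rfl <;> rcases hmem H hH with rfl | rfl <;> simp_all
  refine ⟨{∅, B}, ⟨∅, by simp, B, by simp, by simp [hB]; omega⟩, ?_, ?_, ?_, ?_, ?_⟩
  · rw [Finset.card_pair hB0.symm]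
    exact_mod_cast hc
  · intro H hH
    rcases hmem H hH with rfl | rfl
    · simp
    · simp [hB, hm]
  · intro G hG H hH hGH _
    simp [(hinter G hG H hH hGH).1]
  · intro G hG H hH hGH hs
    exact (hs (hinter G hG H hH hGH).2).elim
  · intro G hG H hH hGH i
    simp [(hinter G hG H hH hGH).1]

end Construction

/-! ### The choice of the constant -/

/-- If `t ^ (D t) ≤ h < (t + 1) ^ (D (t + 1))`, then `(log h)^r / (log log h)^(r-1)` is
`O(t ^ r log t)`. -/
theorem log_pow_div_log_log_pow_le {D t h r : ℕ} (hD : 2 ≤ D) (ht : 2 ≤ t) (hr : 0 < r)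
    (hle : t ^ (D * t) ≤ h) (hlt : h < (t + 1) ^ (D * (t + 1))) :
    1.5 * Real.log h ^ r / Real.log (Real.log h) ^ (r - 1) ≤
      1.5 * (4 * D) ^ r * (t : ℝ) ^ r * Real.log t := by
  have ht2 : (2 : ℝ) ≤ t := by exact_mod_cast ht
  have hD2 : (2 : ℝ) ≤ D := by exact_mod_cast hD
  have hlog2 : (1 / 2 : ℝ) < Real.log 2 := by linarith [Real.log_two_gt_d9]
  have hlogt : (1 / 2 : ℝ) < Real.log t :=
    hlog2.trans_le (Real.log_le_log (by norm_num) ht2)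
  have hh : (0 : ℝ) < h := by
    exact_mod_cast (pow_pos (by omega : 0 < t) _).trans_le hle
  have hlow : (t : ℝ) ≤ Real.log h := by
    have h1 : Real.log ((t : ℝ) ^ (D * t)) ≤ Real.log h :=
      Real.log_le_log (by positivity) (by exact_mod_cast hle)
    rw [Real.log_pow] at h1
    push_cast at h1
    have h2 : 1 ≤ D * Real.log t := by nlinarith
    nlinarith
  have hhigh : Real.log h ≤ 4 * D * (t * Real.log t) := by
    have h1 : Real.log h ≤ Real.log (((t : ℝ) + 1) ^ (D * (t + 1))) :=
      Real.log_le_log hh (by exact_mod_cast hlt.le)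
    rw [Real.log_pow] at h1
    push_cast at h1
    -- For `t ≥ 2` one has `t + 1 ≤ t ^ 2`.
    have h2 : Real.log ((t : ℝ) + 1) ≤ 2 * Real.log t := by
      rw [← Real.log_rpow (by linarith)]
      refine Real.log_le_log (by linarith) ?_
      rw [Real.rpow_two]
      nlinarith
    calc Real.log h ≤ D * (t + 1) * Real.log (t + 1) := h1
      _ ≤ D * (2 * t) * (2 * Real.log t) := by
        have h3 : 0 ≤ Real.log ((t : ℝ) + 1) := Real.log_nonneg (by linarith)
        gcongr
        linarith
      _ = 4 * D * (t * Real.log t) := by ring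
  have hloglog : Real.log t ≤ Real.log (Real.log h) := Real.log_le_log (by linarith) hlow
  have hlogh : 0 ≤ Real.log h := by linarith
  have hpos : 0 < Real.log t := by linarith
  obtain ⟨k, rfl⟩ : ∃ k, r = k + 1 := ⟨r - 1, by omega⟩
  rw [Nat.add_sub_cancel]
  calc 1.5 * Real.log h ^ (k + 1) / Real.log (Real.log h) ^ k
      ≤ 1.5 * (4 * D * (t * Real.log t)) ^ (k + 1) / Real.log t ^ k := by gcongr
    _ = 1.5 * (4 * D) ^ (k + 1) * (t : ℝ) ^ (k + 1) * Real.log t := by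
        field_simp
        ring

theorem exists_pow_mul_self_bracket {D t₀ h : ℕ} (hD : 0 < D)
    (hh : t₀ ^ (D * t₀) ≤ h) :
    ∃ t, t₀ ≤ t ∧ t ^ (D * t) ≤ h ∧ h < (t + 1) ^ (D * (t + 1)) := by
  have hself : ∀ t, t ≤ t ^ (D * t) := fun t => by
    rcases Nat.eq_zero_or_pos t with rfl | ht
    · simp
    · exact Nat.le_self_pow (Nat.mul_pos hD ht).ne' t
  -- The largest admissible `t`; searching up to `h` suffices because `t ≤ t ^ (D * t)`.
  refine ⟨Nat.findGreatest (fun t => t ^ (D * t) ≤ h) h,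
    Nat.le_findGreatest ((hself _).trans hh) hh,
    Nat.findGreatest_spec (P := fun t => t ^ (D * t) ≤ h) ((hself _).trans hh) hh, ?_⟩
  by_contra hcon
  have h1 := not_lt.1 hcon
  have h2 := Nat.le_findGreatest (P := fun t => t ^ (D * t) ≤ h) ((hself _).trans h1) h1
  omega

/-- Since `n + 1 ≤ 2 * n`, the length `n` is at least `t ^ r / (2 * m)`, and `c` absorbs the
remaining constants. -/
theorem sizeBound_le_pow {D t h r m n : ℕ} {c : ℝ} (hD : 2 ≤ D) (ht : 2 ≤ t) (hr : 0 < r)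
    (hm : 0 < m) (hn : 0 < n) (hle : t ^ (D * t) ≤ h) (hlt : h < (t + 1) ^ (D * (t + 1)))
    (htn : t ^ r ≤ m * (n + 1)) (hc0 : 0 ≤ c) (hc : c * (1.5 * (4 * D) ^ r * (2 * m)) ≤ 1) :
    sizeBound c r h ≤ (t : ℝ) ^ n := by
  have ht2 : (2 : ℝ) ≤ t := by exact_mod_cast ht
  have hlogt : 0 < Real.log t := Real.log_pos (by linarith)
  have hn1 : (1 : ℝ) ≤ n := by exact_mod_cast hn
  have htn1 : (t : ℝ) ^ r ≤ m * (n + 1) := by exact_mod_cast htn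
  have htn2 : (t : ℝ) ^ r ≤ 2 * m * n := by
    have : (0 : ℝ) ≤ m := by positivity
    nlinarith
  rw [sizeBound, ← Real.le_log_iff_exp_le (by positivity), Real.log_pow]
  calc c * (1.5 * Real.log h ^ r / Real.log (Real.log h) ^ (r - 1))
      ≤ c * (1.5 * (4 * D) ^ r * (t : ℝ) ^ r * Real.log t) :=
        mul_le_mul_of_nonneg_left (log_pow_div_log_log_pow_le hD ht hr hle hlt) hc0
    _ ≤ c * (1.5 * (4 * D) ^ r * (2 * m * n) * Real.log t) := by gcongr
    _ = c * (1.5 * (4 * D) ^ r * (2 * m)) * (n * Real.log t) := by ring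
    _ ≤ 1 * (n * Real.log t) := by gcongr
    _ = n * Real.log t := one_mul _

/-- Finitely many exponents are bounded by the sum of their absolute values, whatever the iterated
logarithm is at small `h`. -/
theorem exists_constant_sizeBound_lt_two (r h₀ : ℕ) :
    ∃ c₀ : ℝ, 0 < c₀ ∧ ∀ c, 0 ≤ c → c ≤ c₀ → ∀ h < h₀, sizeBound c r h < 2 := by
  set g : ℕ → ℝ := fun h => 1.5 * Real.log h ^ r / Real.log (Real.log h) ^ (r - 1) with hg
  set B : ℝ := ∑ h ∈ Finset.range h₀, |g h| with hB
  have hB0 : 0 ≤ B := Finset.sum_nonneg fun _ _ => abs_nonneg _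
  have hlog2 : 0 < Real.log 2 := Real.log_pos one_lt_two
  refine ⟨Real.log 2 / (B + 1), by positivity, fun c hc0 hc h hh => ?_⟩
  have hgB : g h ≤ B := (le_abs_self _).trans
    (Finset.single_le_sum (f := fun h => |g h|) (fun _ _ => abs_nonneg _) (Finset.mem_range.2 hh))
  rw [sizeBound, ← Real.lt_log_iff_exp_lt two_pos]
  calc c * g h ≤ c * B := mul_le_mul_of_nonneg_left hgB hc0
    _ ≤ Real.log 2 / (B + 1) * B := mul_le_mul_of_nonneg_right hc hB0
    _ < Real.log 2 / (B + 1) * (B + 1) := by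
        have : 0 < Real.log 2 / (B + 1) := by positivity
        nlinarith
    _ = Real.log 2 := by field_simp

/-! ### Characteristic vectors -/

section CharVec

variable {m h : ℕ}

theorem charVec_mul (G H : Finset (Fin h)) : charVec m G * charVec m H = charVec m (G ∩ H) := by
  funext x
  by_cases hG : x ∈ G <;> by_cases hH : x ∈ H <;> simp [charVec, hG, hH]

theorem charVec_dotProduct (G H : Finset (Fin h)) :
    dotProduct (charVec m G) (charVec m H) = ((G ∩ H).card : ZMod m) := by
  have h1 : dotProduct (charVec m G) (charVec m H) = ∑ x, (charVec m G * charVec m H) x := rfl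
  simp only [h1, charVec_mul, charVec, Finset.sum_boole, Finset.filter_univ_mem]

/-- For `1 < m` the entry 1 is nonzero, so the weight counts the members of `G`. -/
theorem hammingNorm_charVec (hm : 1 < m) (G : Finset (Fin h)) :
    hammingNorm (charVec m G) = G.card := by
  have : Fact (1 < m) := ⟨hm⟩
  simp [hammingNorm, charVec]

theorem charVec_injective (hm : 1 < m) : Function.Injective (charVec m (h := h)) := by
  have : Fact (1 < m) := ⟨hm⟩
  intro G H hGH
  ext x
  have h1 := congrFun hGH x
  by_cases hG : x ∈ G <;> by_cases hH : x ∈ H <;> simp_all [charVec]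

end CharVec

theorem mainTheorem2 (r : ℕ) (hr : 1 < r) (p α : Fin r → ℕ)
    (hp : ∀ i, (p i).Prime) (hp_inj : Function.Injective p) (hα : ∀ i, 0 < α i)
    (m : ℕ) (hm : m = ∏ i, p i ^ α i) :
    ∃ c : ℝ, 0 < c ∧ ∃ S : Finset (ZMod m), S.card = 2 ^ r - 1 ∧
      ∀ h : ℕ, m ≤ h →
        (∃ F : Finset (Finset (Fin h)), IsCoveringSetSystem p α c F) ∧
        ∀ F : Finset (Finset (Fin h)), IsCoveringSetSystem p α c F →
          Set.InjOn (charVec m) (F : Set (Finset (Fin h))) ∧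
          IsCoveringFamily S (F.image (charVec m)) ∧
          sizeBound c r h < ((F.image (charVec m)).card : ℝ) ∧
          ∀ G ∈ F, ∀ H ∈ F, dotProduct (charVec m G) (charVec m H) = ((G ∩ H).card : ZMod m) := by
  have hr0 : 0 < r := by omega
  have hrm : r ≤ m := hm ▸ le_prod_primePow hp hα
  have hm1 : 1 < m := by omega
  have hNe : NeZero m := ⟨by omega⟩
  set D : ℕ := (r + 1) * m + m + 2 with hD
  set c₁ : ℝ := 1 / (1.5 * (4 * D) ^ r * (2 * m)) with hc₁
  have hm0 : (0 : ℝ) < m := by exact_mod_cast hm1.le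
  have hD0 : (0 : ℝ) < D := by positivity
  have hc₁0 : 0 < c₁ := by positivity
  -- From `m ^ (D * m)` on, the bracketing `t` is at least `m`, as the word construction requires.
  obtain ⟨c₂, hc₂0, hc₂⟩ := exists_constant_sizeBound_lt_two r (m ^ (D * m))
  refine ⟨min c₁ c₂, lt_min hc₁0 hc₂0, (Finset.univ.filter fun s : ZMod m =>
    ∀ i, s.val % p i ^ α i = 0 ∨ s.val % p i ^ α i = 1).erase 0, ?_, fun h hh => ⟨?_, ?_⟩⟩
  · rw [Finset.card_erase_of_mem (by simp)]
    subst hm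
    rw [card_zeroOneResidues hp hp_inj hα]
  · rcases lt_or_ge h (m ^ (D * m)) with hlt | hge
    · exact exists_isCoveringSetSystem_of_sizeBound_lt_two hp hm hh
        (hc₂ _ (lt_min hc₁0 hc₂0).le (min_le_right _ _) h hlt)
    · obtain ⟨t, hmt, hle, hlt⟩ := exists_pow_mul_self_bracket (by omega : 0 < D) hge
      obtain ⟨n, hn, htn, hF⟩ :=
        exists_isCoveringSetSystem_of_le hr0 hp hp_inj hα hm hmt hle
      refine hF _ (sizeBound_le_pow (by omega) (hm1.trans_le hmt) hr0 (by omega) hn hle hlt htn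
        (lt_min hc₁0 hc₂0).le ?_)
      calc min c₁ c₂ * (1.5 * (4 * D) ^ r * (2 * m)) ≤ c₁ * (1.5 * (4 * D) ^ r * (2 * m)) :=
            mul_le_mul_of_nonneg_right (min_le_left _ _) (by positivity)
        _ = 1 := by rw [hc₁]; field_simp
  · intro F hF
    have hinj : Function.Injective (charVec m (h := h)) := charVec_injective hm1
    refine ⟨hinj.injOn, ⟨by simp, ?_, ?_, ?_⟩, ?_, fun G _ H _ => charVec_dotProduct G H⟩
    · intro v hv
      obtain ⟨G, hG, rfl⟩ := Finset.mem_image.1 hv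
      rw [charVec_dotProduct, Finset.inter_self, ZMod.natCast_eq_zero_iff, hm]
      exact Nat.dvd_of_mod_eq_zero (hF.card_mod G hG)
    · intro u hu v hv _ hd
      obtain ⟨G, hG, rfl⟩ := Finset.mem_image.1 hu
      obtain ⟨H, hH, rfl⟩ := Finset.mem_image.1 hv
      rw [charVec_mul, hammingNorm_charVec hm1] at hd
      rwa [charVec_dotProduct, ZMod.natCast_eq_zero_iff]
    · intro u hu v hv huv hd
      obtain ⟨G, hG, rfl⟩ := Finset.mem_image.1 hu
      obtain ⟨H, hH, rfl⟩ := Finset.mem_image.1 hv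
      rw [charVec_mul, hammingNorm_charVec hm1] at hd
      rw [charVec_dotProduct, Finset.mem_erase, Ne, ZMod.natCast_eq_zero_iff]
      refine ⟨hd, ?_⟩
      simp only [Finset.mem_filter, Finset.mem_univ, true_and]
      intro i
      rw [ZMod.val_natCast, Nat.mod_mod_of_dvd _
        (hm ▸ Finset.dvd_prod_of_mem (fun j => p j ^ α j) (Finset.mem_univ i))]
      exact hF.inter_mod_primePow G hG H hH (fun h => huv (h ▸ rfl)) i
    · rw [Finset.card_image_of_injective _ hinj]
      exact hF.size
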